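/- A distribution is a Borel probability measure $F$ on $[0,1]$, identified with its CDF $[0,1]\to[0,1]$. For distributions $F,G$, call $F$ less informative than $G$ (and $G$ more informative than $F$) if $F$ is a mean-preserving contraction of $G$, i.e. $\int_0^x F \le \int_0^x G$ for every $x\in[0,1]$, with equality at $x=1$ (the integrands being the CDFs). A distribution $F_0$ is binary if $F_0 = p\,\delta_x + (1-p)\,\delta_y$ for some $p,x,y\in[0,1]$. Given a prior distribution $F_0$ of a state in $[0,1]$, a signal is a compact message space $M$ together with a (measurable) map assigning to each state a Borel probability on $M$, according to which the message is drawn; the posterior mean is the conditional expectation of the state given the message. A distribution is feasible given $F_0$ if it is the law of the posterior mean induced by some signal. For sets $S,S'$ of distributions, $S$ is lower than $S'$ (in the weak set order) if for all $F\in S$ and $G\in S'$ there is a distribution in $S'$ that is more informative than $F$, and there is a distribution in $S$ that is less informative than $G$. For $u,v:[0,1]\to\mathbb{R}$, say that $u$ is ordinally less convex than $v$ if for any $x<y$ in $[0,1]$ such that $$u(\alpha x+(1-\alpha)y)\le \alpha u(x)+(1-\alpha)u(y)\quad\text{for every }\alpha\in(0,1),$$ we also have $v(\alpha x+(1-\alpha)y)\le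 \alpha v(x)+(1-\alpha)v(y)$ for every $\alpha\in(0,1)$, and furthermore the inequality for $v$ is strict at every $\alpha\in(0,1)$ at which the inequality for $u$ is strict. Let $u,v:[0,1]\to\mathbb{R}$ be upper semi-continuous. (The integrals $\int u\,dF$, $\int v\,dF$ are then well defined with values in $[-\infty,\infty)$.) If $u$ is ordinally less convex than $v$, then for every binary distribution $F_0$, $$\operatorname*{arg\,max}_{F\text{ feasible given }F_0}\int u\,dF\quad\text{is lower than}\quad \operatorname*{arg\,max}_{F\text{ feasible given }F_0}\int v\,dF. \qquad(\star\star)$$ Conversely, if $(\star\star)$ holds for every binary distribution $F_0$, then $u$ is ordinally less convex than $v$. -/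

import Mathlib

open MeasureTheory ProbabilityTheory
open scoped ENNReal

noncomputable section

namespace Persuasion

/-- A distribution on `[0,1]`: a Borel probability measure, identified with its CDF. -/
abbrev Dist : Type := ProbabilityMeasure unitInterval

/-- The CDF of a distribution on `[0,1]`, as a function on the real line. -/
def Dist.cdf (F : Dist) (t : ℝ) : ℝ :=
  ProbabilityTheory.cdf ((F : Measure unitInterval).map Subtype.val) t

/-- `F` is less informative than `G`, i.e. `F` is a mean-preserving contraction of `G`:
`∫_0^x F ≤ ∫_0^x G` for every `x ∈ [0,1]`, with equality at `x = 1`. -/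
def LessInformative (F G : Dist) : Prop :=
  (∀ x : unitInterval, ∫ t in (0 : ℝ)..(x : ℝ), F.cdf t ≤ ∫ t in (0 : ℝ)..(x : ℝ), G.cdf t) ∧
    ∫ t in (0 : ℝ)..1, F.cdf t = ∫ t in (0 : ℝ)..1, G.cdf t

/-- The posterior mean of the state given the message, as a random variable on the product of the
state space `[0,1]` and the message space `M`, when the state is drawn from the prior `F₀` and the
message is then drawn from `π` evaluated at the state. -/
def posteriorMean {M : Type} [MeasurableSpace M] (F₀ : Dist) (π : Kernel unitInterval M) :
    unitInterval × M → ℝ :=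
  ((F₀ : Measure unitInterval) ⊗ₘ π)[fun p => (p.1 : ℝ) |
    MeasurableSpace.comap (Prod.snd : unitInterval × M → M) inferInstance]

/-- `F` is feasible given the prior `F₀`: it is the law of the posterior mean induced by some signal
`(M, π)`, where `M` is compact and `π` maps states to Borel probabilities on `M`. -/
def Feasible (F₀ F : Dist) : Prop :=
  ∃ (M : Type) (_ : TopologicalSpace M) (_ : CompactSpace M) (_ : MeasurableSpace M)
    (_ : BorelSpace M) (π : Kernel unitInterval M) (_ : IsMarkovKernel π),
    (F : Measure unitInterval).map Subtype.val =
      ((F₀ : Measure unitInterval) ⊗ₘ π).map (posteriorMean F₀ π)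

/-- The expected payoff `∫ u dF` with values in `[-∞, ∞]`, as the integral of the positive part minus
the integral of the negative part. For `u` upper semi-continuous on `[0,1]` (hence bounded above) the
former is finite, so that the difference is well defined; it may equal `-∞`. -/
def expectedPayoff (u : unitInterval → ℝ) (F : Dist) : EReal :=
  ((∫⁻ x, ENNReal.ofReal (u x) ∂(F : Measure unitInterval) : ℝ≥0∞) : EReal) -
    ((∫⁻ x, ENNReal.ofReal (-u x) ∂(F : Measure unitInterval) : ℝ≥0∞) : EReal)

/-- The set of optimal distributions: those maximising `∫ u dF` among all `F` feasible given `F₀`. -/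
def optimal (u : unitInterval → ℝ) (F₀ : Dist) : Set Dist :=
  {F | Feasible F₀ F ∧ ∀ G : Dist, Feasible F₀ G → expectedPayoff u G ≤ expectedPayoff u F}

/-- `S` is lower than `S'` in the weak set order induced by informativeness. -/
def Lower (S S' : Set Dist) : Prop :=
  ∀ F ∈ S, ∀ G ∈ S', (∃ F' ∈ S', LessInformative F F') ∧ (∃ G' ∈ S, LessInformative G' G)

/-- The point `α x + (1 - α) y` of `[0,1]`. -/
def mix (α x y : unitInterval) : unitInterval :=
  ⟨(α : ℝ) * x + (1 - (α : ℝ)) * y,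
    convex_Icc (0 : ℝ) 1 x.2 y.2 α.2.1 (sub_nonneg.2 α.2.2) (by ring)⟩

/-- `u` is ordinally less convex than `v`. -/
def OrdinallyLessConvex (u v : unitInterval → ℝ) : Prop :=
  ∀ x y : unitInterval, x < y →
    (∀ α : unitInterval, 0 < α → α < 1 →
      u (mix α x y) ≤ (α : ℝ) * u x + (1 - (α : ℝ)) * u y) →
    (∀ α : unitInterval, 0 < α → α < 1 →
      v (mix α x y) ≤ (α : ℝ) * v x + (1 - (α : ℝ)) * v y) ∧
    (∀ α : unitInterval, 0 < α → α < 1 →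
      u (mix α x y) < (α : ℝ) * u x + (1 - (α : ℝ)) * u y →
      v (mix α x y) < (α : ℝ) * v x + (1 - (α : ℝ)) * v y)

/-- `F` is binary: `F = p δ_x + (1 - p) δ_y` for some `p, x, y ∈ [0,1]`. -/
def Binary (F : Dist) : Prop :=
  ∃ p x y : unitInterval, (F : Measure unitInterval) =
    ENNReal.ofReal (p : ℝ) • Measure.dirac x + ENNReal.ofReal (1 - (p : ℝ)) • Measure.dirac y

end Persuasion

end

/-! Given a nondegenerate binary prior on {x, y} with mean μ, the feasible distributions are exactly
those on [x, y] with mean μ, so optimisation is concavification. Upper semicontinuity gives a line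
above `u` on [x, y] that touches `u` weakly on each side of μ, and a feasible distribution is
optimal iff it is carried by the contact points (`exists_line_optimal`). The theorem thus compares
contact sets, using that a distribution on [a, b] is less informative than any distribution off (a,
b) with the same mean (`lessInformative_of_interval`).

Forward: if the line of `v` touches strictly between two contact points z < w of `u`, then `u`,
hence `v`, is below its chord on [z, w], which forces contact of `v` at z and w (`contact_mem`). So
an optimum for `u` is either degenerate at μ or lies between the extreme contact points of `v`, and
the optimum on those two points is more informative. Conversely, let a ≤ μ ≤ b be the contact points
of `u` nearest to μ. On (a, b) `u` is strictly below its chord, hence so is `v`, which cannot touch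
its line there. Every optimum for `v` thus lives off (a, b) and is more informative than the optimum
for `u` on {a, b}.

For the converse of the theorem, suppose `u` is below its chord on [x, y]. Full revelation is then
optimal for `u`; whatever is more informative is full revelation again, so `v` weakly prefers it to
no information. If `v` is indifferent, no information is optimal for `v`, hence for `u`, and `u`
cannot be strictly below its chord. -/

namespace Persuasion

/-! ### Supporting lines of upper semicontinuous functions -/

/-- A nonnegative weight times a nonpositive upper semicontinuous function, jointly in the weight and
the point, is upper semicontinuous. -/
lemma upperSemicontinuous_mul_of_nonpos {X : Type*} [TopologicalSpace X]
    {l w : X → ℝ} (hl : Continuous l) (hl0 : ∀ p, 0 ≤ l p)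
    (hw : UpperSemicontinuous w) (hw0 : ∀ p, w p ≤ 0) :
    UpperSemicontinuous fun p => l p * w p := by
  intro p c hc
  rcases lt_or_ge 0 c with h | h
  · exact Filter.Eventually.of_forall fun q =>
      lt_of_le_of_lt (mul_nonpos_of_nonneg_of_nonpos (hl0 q) (hw0 q)) h
  -- A negative or zero bound strictly above the product excludes weight zero, so dividing by the
  -- weight is legitimate.
  have hlp : 0 < l p := (hl0 p).lt_of_ne fun h0 => by
    simp only [← h0, zero_mul] at hc
    linarith
  have h1 : w p < c / l p := by rwa [lt_div_iff₀ hlp, mul_comm]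
  obtain ⟨w1, hw1, hw1'⟩ := exists_between h1
  have hc0 : c / l p ≤ 0 := div_nonpos_of_nonpos_of_nonneg h hlp.le
  have hev : ∀ᶠ q in nhds p, l q * w1 < c := by
    have : Filter.Tendsto (fun q => l q * w1) (nhds p) (nhds (l p * w1)) :=
      (hl.tendsto p).mul_const w1
    refine this.eventually_lt_const ?_
    rw [lt_div_iff₀ hlp] at hw1'
    linarith
  filter_upwards [hev, hw p w1 hw1] with q h2 h3
  exact lt_of_le_of_lt (mul_le_mul_of_nonneg_left h3.le (hl0 q)) h2

lemma exists_upper_bound {u : unitInterval → ℝ} (hu : UpperSemicontinuous u) :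
    ∃ M : ℝ, ∀ m, u m ≤ M := by
  obtain ⟨M, hM⟩ := (hu.upperSemicontinuousOn Set.univ).bddAbove_of_isCompact isCompact_univ
  exact ⟨M, fun m => hM ⟨m, trivial, rfl⟩⟩

/-- Among all pairs of points of `[x, y]` around `μ` there is one whose chord of `u` is highest at `μ`. -/
lemma exists_best_chord {u : unitInterval → ℝ} (hu : UpperSemicontinuous u)
    {x μ y : unitInterval} (hx : x < μ) (hy : μ < y) :
    ∃ a b l : unitInterval, a ∈ Set.Icc x μ ∧ b ∈ Set.Icc μ y ∧
      (l * a + (1 - l) * b : ℝ) = μ ∧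
      ∀ a' b' l' : unitInterval, a' ∈ Set.Icc x μ → b' ∈ Set.Icc μ y →
        (l' * a' + (1 - l') * b' : ℝ) = μ →
        (l' * u a' + (1 - l') * u b' : ℝ) ≤ l * u a + (1 - l) * u b := by
  obtain ⟨M, hM⟩ := exists_upper_bound hu
  let K : Set (unitInterval × unitInterval × unitInterval) :=
    {p | p.1 ∈ Set.Icc x μ} ∩ {p | p.2.1 ∈ Set.Icc μ y} ∩
      {p | (p.2.2 * p.1 + (1 - p.2.2) * p.2.1 : ℝ) = μ}
  have hK : IsCompact K := by
    apply IsClosed.isCompact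
    refine (IsClosed.inter (isClosed_Icc.preimage continuous_fst)
      (isClosed_Icc.preimage (continuous_fst.comp continuous_snd))).inter ?_
    exact isClosed_eq (by fun_prop) continuous_const
  have hne : K.Nonempty := ⟨(μ, μ, 0), ⟨⟨hx.le, le_rfl⟩, ⟨le_rfl, hy.le⟩⟩, by simp⟩
  -- Subtracting the bound `M` makes both factors nonpositive, as the product lemma requires; since
  -- the weights sum to one, it only shifts the objective.
  let f : unitInterval × unitInterval × unitInterval → ℝ := fun p =>
    (p.2.2 : ℝ) * (u p.1 - M) + (1 - (p.2.2 : ℝ)) * (u p.2.1 - M)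
  have husc : UpperSemicontinuous fun m => u m - M := by
    simpa only [sub_eq_add_neg] using
      hu.add (continuous_const (y := -M)).upperSemicontinuous
  have hf : UpperSemicontinuous f := by
    apply UpperSemicontinuous.add
    · exact upperSemicontinuous_mul_of_nonpos (by fun_prop) (fun p => p.2.2.2.1)
        (husc.comp continuous_fst) (fun p => sub_nonpos.2 (hM _))
    · exact upperSemicontinuous_mul_of_nonpos (by fun_prop) (fun p => sub_nonneg.2 p.2.2.2.2)
        (husc.comp (continuous_fst.comp continuous_snd)) (fun p => sub_nonpos.2 (hM _))
  obtain ⟨⟨a, b, l⟩, ⟨⟨ha, hb⟩, hl⟩, hmax⟩ :=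
    (hf.upperSemicontinuousOn K).exists_isMaxOn hne hK
  refine ⟨a, b, l, ha, hb, hl, fun a' b' l' ha' hb' hl' => ?_⟩
  have h := hmax (show (a', b', l') ∈ K from ⟨⟨ha', hb'⟩, hl'⟩)
  simp only [f, Set.mem_ofPred_eq] at h
  linarith

/-- A line through `(μ, V)` dominates `u` on `[x, y]` if no chord of `u` around `μ` passes above
`(μ, V)`. -/
lemma exists_slope {u : unitInterval → ℝ} {x μ y : unitInterval} (hx : x < μ) (hy : μ < y)
    {V : ℝ} (hV : u μ ≤ V)
    (hc : ∀ a b : unitInterval, a ∈ Set.Ico x μ → b ∈ Set.Ioc μ y →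
      u a * (b - μ) + u b * (μ - a) ≤ V * (b - a)) :
    ∃ s : ℝ, ∀ m ∈ Set.Icc x y, u m ≤ V + s * (m - μ) := by
  -- Slopes from (μ, V) to points of the graph on the right. The chord condition bounds each by
  -- every slope from the left, so the supremum separates the two families.
  let S : Set ℝ := (fun b : unitInterval => (u b - V) / ((b : ℝ) - μ)) '' Set.Ioc μ y
  have hle : ∀ a ∈ Set.Ico x μ, ∀ r ∈ S, r ≤ (V - u a) / ((μ : ℝ) - a) := by
    rintro a ha _ ⟨b, hb, rfl⟩
    have h1 : (0 : ℝ) < b - μ := sub_pos.2 hb.1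
    have h2 : (0 : ℝ) < μ - a := sub_pos.2 ha.2
    rw [div_le_div_iff₀ h1 h2]
    have := hc a b ha hb
    linarith
  have hbdd : BddAbove S := ⟨_, fun r hr => hle x ⟨le_rfl, hx⟩ r hr⟩
  have hne : S.Nonempty := ⟨_, y, ⟨hy, le_rfl⟩, rfl⟩
  refine ⟨sSup S, fun m hm => ?_⟩
  rcases lt_trichotomy m μ with h | h | h
  · have h2 : (0 : ℝ) < μ - m := sub_pos.2 h
    have := csSup_le hne (hle m ⟨hm.1, h⟩)
    rw [le_div_iff₀ h2] at this
    linarith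
  · subst h
    simpa using hV
  · have h1 : (0 : ℝ) < m - μ := sub_pos.2 h
    have := le_csSup hbdd (⟨m, ⟨h, hm.2⟩, rfl⟩ : (u m - V) / ((m : ℝ) - μ) ∈ S)
    rw [div_le_iff₀ h1] at this
    linarith

/-- The point of `[a, b]` with given weights. -/
lemma exists_weight {a μ b : unitInterval} (ha : a < μ) (hb : μ < b) :
    ∃ l : unitInterval, 0 < l ∧ l < 1 ∧ (l : ℝ) * (b - a) = b - μ ∧ mix l a b = μ := by
  have h1 : (0 : ℝ) < b - μ := sub_pos.2 hb
  have h2 : (0 : ℝ) < μ - a := sub_pos.2 ha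
  have h3 : (0 : ℝ) < b - a := by linarith
  have h4 : 0 < ((b : ℝ) - μ) / (b - a) := div_pos h1 h3
  have h5 : ((b : ℝ) - μ) / (b - a) < 1 := by
    rw [div_lt_one h3]
    linarith
  refine ⟨⟨_, h4.le, h5.le⟩, h4, h5, div_mul_cancel₀ _ h3.ne', Subtype.ext ?_⟩
  simp only [mix]
  field_simp
  ring

/-- An upper semicontinuous function on `[x, y]` has a supporting line at `μ`, which it touches on
both sides of `μ`. -/
lemma exists_support_line {u : unitInterval → ℝ} (hu : UpperSemicontinuous u)
    {x μ y : unitInterval} (hx : x < μ) (hy : μ < y) :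
    ∃ V s : ℝ, (∀ m ∈ Set.Icc x y, u m ≤ V + s * (m - μ)) ∧
      (∃ a ∈ Set.Icc x μ, u a = V + s * (a - μ)) ∧
      ∃ b ∈ Set.Icc μ y, u b = V + s * (b - μ) := by
  obtain ⟨a, b, l, ha, hb, hl, hmax⟩ := exists_best_chord hu hx hy
  set V : ℝ := l * u a + (1 - l) * u b with hV
  have hμV : u μ ≤ V := by
    have := hmax μ μ 0 ⟨hx.le, le_rfl⟩ ⟨le_rfl, hy.le⟩ (by simp)
    simpa using this
  obtain ⟨s, hs⟩ := exists_slope hx hy hμV fun a' b' ha' hb' => by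
    obtain ⟨t, -, -, ht, hmix⟩ := exists_weight ha'.2 hb'.1
    have h := hmax a' b' t ⟨ha'.1, ha'.2.le⟩ ⟨hb'.1.le, hb'.2⟩ (congrArg Subtype.val hmix)
    have h3 : (0 : ℝ) ≤ b' - a' := sub_nonneg.2 (ha'.2.le.trans hb'.1.le)
    have := mul_le_mul_of_nonneg_right h h3
    have e : (t * u a' + (1 - t) * u b') * ((b' : ℝ) - a') =
        u a' * (b' - μ) + u b' * (μ - a') := by
      linear_combination (u a' - u b') * ht
    linarith
  refine ⟨V, s, hs, ?_⟩
  have h1 := hs a ⟨ha.1, ha.2.trans hy.le⟩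
  have h2 := hs b ⟨hx.le.trans hb.1, hb.2⟩
  -- The line has value V at μ, so the weighted gaps below it at a and b sum to zero. Both are
  -- nonnegative, so each endpoint of positive weight is a contact point.
  have hsum : (l : ℝ) * (V + s * (a - μ) - u a) + (1 - l) * (V + s * (b - μ) - u b) = 0 := by
    linear_combination s * hl + hV
  have hl0 : (0 : ℝ) ≤ l := l.2.1
  have hl1 : (0 : ℝ) ≤ 1 - l := sub_nonneg.2 l.2.2
  have t1 := mul_nonneg hl0 (sub_nonneg.2 h1)
  have t2 := mul_nonneg hl1 (sub_nonneg.2 h2)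
  have e1 : (l : ℝ) * (V + s * (a - μ) - u a) = 0 := by linarith
  have e2 : (1 - l : ℝ) * (V + s * (b - μ) - u b) = 0 := by linarith
  -- If one weight vanishes, the other endpoint is μ itself, which then serves as the contact point
  -- on both sides.
  have touch : u μ = V → (∃ a ∈ Set.Icc x μ, u a = V + s * (a - μ)) ∧
      ∃ b ∈ Set.Icc μ y, u b = V + s * (b - μ) := fun h =>
    ⟨⟨μ, ⟨hx.le, le_rfl⟩, by simpa using h⟩, ⟨μ, ⟨le_rfl, hy.le⟩, by simpa using h⟩⟩
  rcases mul_eq_zero.1 e1 with h | h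
  · apply touch
    have : b = μ := Subtype.ext (by simpa [h] using hl)
    rw [hV, h, this]
    ring
  rcases mul_eq_zero.1 e2 with h' | h'
  · apply touch
    have hl' : (l : ℝ) = 1 := by linarith
    have : a = μ := Subtype.ext (by simpa [hl'] using hl)
    rw [hV, hl', this]
    ring
  · exact ⟨⟨a, ha, by linarith⟩, ⟨b, hb, by linarith⟩⟩

/-! ### Ordinal convexity in terms of chords -/

/-- The value at `m` of the chord of `u` over `[a, b]`, multiplied by `b - a`. -/
def chordMul (u : unitInterval → ℝ) (a b m : unitInterval) : ℝ :=
  u a * (b - m) + u b * (m - a)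

/-- Ordinal comparison of convexity, in terms of chords. -/
lemma OrdinallyLessConvex.chord {u v : unitInterval → ℝ} (h : OrdinallyLessConvex u v)
    {a b : unitInterval} (hab : a < b)
    (hu : ∀ m ∈ Set.Ioo a b, u m * (b - a) ≤ chordMul u a b m) :
    (∀ m ∈ Set.Ioo a b, v m * (b - a) ≤ chordMul v a b m) ∧
    ∀ m ∈ Set.Ioo a b, u m * (b - a) < chordMul u a b m → v m * (b - a) < chordMul v a b m := by
  have hba : (0 : ℝ) < b - a := sub_pos.2 hab
  have key : ∀ (w : unitInterval → ℝ) (t : unitInterval),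
      (t * w a + (1 - t) * w b) * ((b : ℝ) - a) = chordMul w a b (mix t a b) := by
    intro w t
    simp only [chordMul, mix]
    ring
  obtain ⟨h1, h2⟩ := h a b hab fun t ht0 ht1 => by
    refine le_of_mul_le_mul_right ?_ hba
    rw [key]
    have ht0' : (0 : ℝ) < t := ht0
    have ht1' : (t : ℝ) < 1 := ht1
    refine hu _ ⟨?_, ?_⟩ <;> rw [← Subtype.coe_lt_coe] <;> simp only [mix] <;> nlinarith
  refine ⟨fun m hm => ?_, fun m hm hlt => ?_⟩ <;>
    obtain ⟨t, ht0, ht1, -, rfl⟩ := exists_weight hm.1 hm.2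
  · rw [← key]
    exact mul_le_mul_of_nonneg_right (h1 t ht0 ht1) hba.le
  · rw [← key] at hlt ⊢
    exact mul_lt_mul_of_pos_right (h2 t ht0 ht1 (lt_of_mul_lt_mul_right hlt hba.le)) hba


/-! ### Feasible distributions -/

/-- The mean of a distribution. -/
noncomputable def Dist.mean (F : Dist) : ℝ := ∫ m, (m : ℝ) ∂(F : Measure unitInterval)

lemma integrable_of_continuous (F : Dist) {g : unitInterval → ℝ} (hg : Continuous g) :
    Integrable g (F : Measure unitInterval) :=
  integrableOn_univ.1 (hg.continuousOn.integrableOn_compact isCompact_univ)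

lemma integral_affine (F : Dist) (c s : ℝ) :
    ∫ m, (c + s * (m : ℝ)) ∂(F : Measure unitInterval) = c + s * F.mean := by
  rw [integral_add (integrable_const _)
    (integrable_of_continuous F (by fun_prop)), integral_const_mul]
  simp [Dist.mean]

lemma comap_snd_le {M : Type} [MeasurableSpace M] :
    MeasurableSpace.comap (Prod.snd : unitInterval × M → M) inferInstance ≤
      (inferInstance : MeasurableSpace (unitInterval × M)) :=
  measurable_snd.comap_le

lemma integrable_state {M : Type} [MeasurableSpace M] (ρ : Measure (unitInterval × M))
    [IsFiniteMeasure ρ] : Integrable (fun p => (p.1 : ℝ)) ρ :=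
  Integrable.of_bound (measurable_subtype_coe.comp measurable_fst).aestronglyMeasurable 1
    (Filter.Eventually.of_forall fun p => by
      rw [Real.norm_of_nonneg p.1.2.1]
      exact p.1.2.2)

lemma measurable_posteriorMean {M : Type} [MeasurableSpace M] (F₀ : Dist)
    (π : Kernel unitInterval M) : Measurable (posteriorMean F₀ π) :=
  (stronglyMeasurable_condExp.mono comap_snd_le).measurable

/-- The posterior mean stays within the bounds of the prior, and averages to the prior mean. -/
lemma Feasible.bounds {F₀ F : Dist} (h : Feasible F₀ F) {a b : unitInterval}
    (hF₀ : ∀ᵐ m ∂(F₀ : Measure unitInterval), m ∈ Set.Icc a b) :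
    (∀ᵐ m ∂(F : Measure unitInterval), m ∈ Set.Icc a b) ∧ F.mean = F₀.mean := by
  obtain ⟨M, _, _, _, _, π, _, hmap⟩ := h
  have hmeas := measurable_posteriorMean F₀ π
  set ρ := (F₀ : Measure unitInterval) ⊗ₘ π with hρ
  have hfst : ρ.map Prod.fst = (F₀ : Measure unitInterval) := Measure.fst_compProd _ _
  have hst : ∀ᵐ p ∂ρ, p.1 ∈ Set.Icc a b := by
    rw [← hfst] at hF₀
    exact ae_of_ae_map measurable_fst.aemeasurable hF₀
  have hlow : ∀ᵐ p ∂ρ, (a : ℝ) ≤ posteriorMean F₀ π p := by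
    have := condExp_mono (m := MeasurableSpace.comap (Prod.snd : unitInterval × M → M) inferInstance)
      (integrable_const (μ := ρ) (a : ℝ)) (integrable_state ρ)
      (hst.mono fun p hp => hp.1)
    rwa [condExp_const comap_snd_le] at this
  have hup : ∀ᵐ p ∂ρ, posteriorMean F₀ π p ≤ (b : ℝ) := by
    have := condExp_mono (m := MeasurableSpace.comap (Prod.snd : unitInterval × M → M) inferInstance)
      (integrable_state ρ) (integrable_const (μ := ρ) (b : ℝ))
      (hst.mono fun p hp => hp.2)
    rwa [condExp_const comap_snd_le] at this
  constructor
  · have : ∀ᵐ r ∂(ρ.map (posteriorMean F₀ π)), r ∈ Set.Icc (a : ℝ) b := by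
      refine (ae_map_iff hmeas.aemeasurable (p := fun r => r ∈ Set.Icc (a : ℝ) b)
        measurableSet_Icc).2 ?_
      filter_upwards [hlow, hup] with p h1 h2 using ⟨h1, h2⟩
    rw [← hmap] at this
    exact ae_of_ae_map measurable_subtype_coe.aemeasurable this
  · calc F.mean = ∫ r, r ∂((F : Measure unitInterval).map Subtype.val) :=
          (integral_map measurable_subtype_coe.aemeasurable
            aestronglyMeasurable_id).symm
      _ = ∫ p, posteriorMean F₀ π p ∂ρ := by
          rw [hmap]
          exact integral_map hmeas.aemeasurable aestronglyMeasurable_id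
      _ = ∫ p, (p.1 : ℝ) ∂ρ := integral_condExp comap_snd_le
      _ = F₀.mean := by
          rw [Dist.mean, ← hfst, integral_map measurable_fst.aemeasurable
            measurable_subtype_coe.aestronglyMeasurable]

/-- A joint law of state and message in which the message is the conditional mean of the state makes
the law of the message feasible. -/
lemma feasible_of_joint_law {F₀ F : Dist} (ρ : Measure (unitInterval × unitInterval))
    [IsFiniteMeasure ρ] (hfst : ρ.fst = (F₀ : Measure unitInterval))
    (hsnd : ρ.snd = (F : Measure unitInterval))
    (hmean : ∀ B : Set unitInterval, MeasurableSet B →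
      ∫ p in Prod.snd ⁻¹' B, (p.1 : ℝ) ∂ρ = ∫ m in B, (m : ℝ) ∂(F : Measure unitInterval)) :
    Feasible F₀ F := by
  -- The message is the posterior mean itself, and the signal is the conditional law of the message
  -- given the state.
  refine ⟨unitInterval, inferInstance, inferInstance, inferInstance, inferInstance,
    ρ.condKernel, inferInstance, ?_⟩
  have hρ : (F₀ : Measure unitInterval) ⊗ₘ ρ.condKernel = ρ := by
    rw [← hfst]
    exact ρ.disintegrate ρ.condKernel
  have hint : Integrable (fun p : unitInterval × unitInterval => (p.2 : ℝ)) ρ :=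
    Integrable.of_bound (measurable_subtype_coe.comp measurable_snd).aestronglyMeasurable 1
      (Filter.Eventually.of_forall fun p => by
        rw [Real.norm_of_nonneg p.2.2.1]
        exact p.2.2.2)
  have hpm : (fun p : unitInterval × unitInterval => (p.2 : ℝ)) =ᵐ[ρ]
      posteriorMean F₀ ρ.condKernel := by
    rw [posteriorMean, hρ]
    refine ae_eq_condExp_of_forall_setIntegral_eq comap_snd_le (integrable_state ρ)
      (fun s _ _ => hint.integrableOn) ?_ ?_
    · rintro s ⟨B, hB, rfl⟩ -
      rw [hmean B hB, ← hsnd, Measure.snd,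
        setIntegral_map hB measurable_subtype_coe.aestronglyMeasurable measurable_snd.aemeasurable]
    · exact ((measurable_subtype_coe.comp (comap_measurable _)).stronglyMeasurable).aestronglyMeasurable
  rw [hρ, ← Measure.map_congr hpm, ← hsnd, Measure.snd,
    Measure.map_map measurable_subtype_coe measurable_snd]
  rfl

/-- Every distribution on `[x, y]` with the mean of a binary prior on `{x, y}` is feasible. -/
lemma feasible_of_binary {F₀ F : Dist} {p x y : unitInterval} (hxy : x < y)
    (hF₀ : (F₀ : Measure unitInterval) =
      ENNReal.ofReal (p : ℝ) • Measure.dirac x + ENNReal.ofReal (1 - (p : ℝ)) • Measure.dirac y)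
    (hF : ∀ᵐ m ∂(F : Measure unitInterval), m ∈ Set.Icc x y)
    (hmean : F.mean = p * x + (1 - p) * y) : Feasible F₀ F := by
  have hd : (0 : ℝ) < y - x := sub_pos.2 hxy
  -- By Bayes' rule, a posterior on {x, y} with mean m puts weight `w m` on x and `w' m` on y. The
  -- joint law has densities `w` and `w'` with respect to `F` over the two states; their total
  -- masses are the prior weights because the means agree.
  set w : unitInterval → ℝ := fun m => ((y : ℝ) - m) / (y - x) with hw
  set w' : unitInterval → ℝ := fun m => ((m : ℝ) - x) / (y - x) with hw'
  have hwc : Continuous w := by fun_prop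
  have hwc' : Continuous w' := by fun_prop
  have hw0 : ∀ᵐ m ∂(F : Measure unitInterval), 0 ≤ w m :=
    hF.mono fun m hm => div_nonneg (sub_nonneg.2 hm.2) hd.le
  have hw0' : ∀ᵐ m ∂(F : Measure unitInterval), 0 ≤ w' m :=
    hF.mono fun m hm => div_nonneg (sub_nonneg.2 hm.1) hd.le
  have hmw : Measurable fun m => ENNReal.ofReal (w m) := hwc.measurable.ennreal_ofReal
  have hmw' : Measurable fun m => ENNReal.ofReal (w' m) := hwc'.measurable.ennreal_ofReal
  have hiw : ∫ m, w m ∂(F : Measure unitInterval) = p := by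
    have : ∀ m, w m = y / (y - x) + (-1 / (y - x)) * (m : ℝ) := fun m => by
      simp only [hw]
      ring
    simp_rw [this]
    rw [integral_affine, hmean]
    field_simp
    ring
  have hiw' : ∫ m, w' m ∂(F : Measure unitInterval) = 1 - p := by
    have : ∀ m, w' m = -x / (y - x) + (1 / (y - x)) * (m : ℝ) := fun m => by
      simp only [hw']
      ring
    simp_rw [this]
    rw [integral_affine, hmean]
    field_simp
    ring
  set ν := (F : Measure unitInterval).withDensity fun m => ENNReal.ofReal (w m) with hν
  set ν' := (F : Measure unitInterval).withDensity fun m => ENNReal.ofReal (w' m) with hν'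
  have hmass : ν Set.univ = ENNReal.ofReal (p : ℝ) := by
    rw [hν, withDensity_apply _ MeasurableSet.univ, Measure.restrict_univ,
      ← ofReal_integral_eq_lintegral_ofReal (integrable_of_continuous F hwc) hw0, hiw]
  have hmass' : ν' Set.univ = ENNReal.ofReal (1 - (p : ℝ)) := by
    rw [hν', withDensity_apply _ MeasurableSet.univ, Measure.restrict_univ,
      ← ofReal_integral_eq_lintegral_ofReal (integrable_of_continuous F hwc') hw0', hiw']
  have : IsFiniteMeasure ν := ⟨by rw [hmass]; exact ENNReal.ofReal_lt_top⟩
  have : IsFiniteMeasure ν' := ⟨by rw [hmass']; exact ENNReal.ofReal_lt_top⟩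
  have hx : Measurable (Prod.mk x : unitInterval → unitInterval × unitInterval) :=
    measurable_prodMk_left
  have hy : Measurable (Prod.mk y : unitInterval → unitInterval × unitInterval) :=
    measurable_prodMk_left
  refine feasible_of_joint_law (ν.map (Prod.mk x) + ν'.map (Prod.mk y)) ?_ ?_ ?_
  · rw [Measure.fst, Measure.map_add _ _ measurable_fst, Measure.map_map measurable_fst hx,
      Measure.map_map measurable_fst hy, hF₀, ← hmass, ← hmass', ← Measure.map_const,
      ← Measure.map_const]
    rfl
  · rw [Measure.snd, Measure.map_add _ _ measurable_snd, Measure.map_map measurable_snd hx,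
      Measure.map_map measurable_snd hy]
    change ν.map id + ν'.map id = _
    rw [Measure.map_id, Measure.map_id, hν, hν', ← withDensity_add_left hmw]
    conv_rhs => rw [← withDensity_one (μ := (F : Measure unitInterval))]
    refine withDensity_congr_ae ?_
    filter_upwards [hw0, hw0'] with m h1 h2
    simp only [Pi.add_apply, Pi.one_apply]
    rw [← ENNReal.ofReal_add h1 h2, ← ENNReal.ofReal_one]
    congr 1
    simp only [hw, hw']
    field_simp
    ring
  · intro B hB
    have hmf : Measurable fun p : unitInterval × unitInterval => (p.1 : ℝ) :=
      measurable_subtype_coe.comp measurable_fst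
    have hpre : MeasurableSet (Prod.snd ⁻¹' B : Set (unitInterval × unitInterval)) :=
      measurable_snd hB
    rw [Measure.restrict_add, integral_add_measure (integrable_state _) (integrable_state _),
      setIntegral_map hpre hmf.aestronglyMeasurable hx.aemeasurable,
      setIntegral_map hpre hmf.aestronglyMeasurable hy.aemeasurable]
    change ∫ _ in B, (x : ℝ) ∂ν + ∫ _ in B, (y : ℝ) ∂ν' = _
    rw [hν, hν', setIntegral_withDensity_eq_setIntegral_toReal_smul hmw
        (Filter.Eventually.of_forall fun _ => ENNReal.ofReal_lt_top) _ hB,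
      setIntegral_withDensity_eq_setIntegral_toReal_smul hmw'
        (Filter.Eventually.of_forall fun _ => ENNReal.ofReal_lt_top) _ hB]
    have e : ∀ᵐ m ∂(F : Measure unitInterval).restrict B,
        (ENNReal.ofReal (w m)).toReal • (x : ℝ) = w m * x ∧
        (ENNReal.ofReal (w' m)).toReal • (y : ℝ) = w' m * y := by
      filter_upwards [ae_restrict_of_ae hw0, ae_restrict_of_ae hw0'] with m h1 h2
      rw [ENNReal.toReal_ofReal h1, ENNReal.toReal_ofReal h2]
      exact ⟨rfl, rfl⟩
    rw [integral_congr_ae (e.mono fun m h => h.1), integral_congr_ae (e.mono fun m h => h.2),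
      ← integral_add]
    · refine integral_congr_ae (Filter.Eventually.of_forall fun m => ?_)
      simp only [hw, hw']
      field_simp
      ring
    · exact (integrable_of_continuous F (by fun_prop)).integrableOn
    · exact (integrable_of_continuous F (by fun_prop)).integrableOn

/-! ### Integrated CDFs and the informativeness order -/

lemma Dist.cdf_eq_integral (F : Dist) (r : ℝ) :
    F.cdf r = ∫ m, (if (m : ℝ) ≤ r then 1 else 0 : ℝ) ∂(F : Measure unitInterval) := by
  have : IsProbabilityMeasure ((F : Measure unitInterval).map Subtype.val) :=
    Measure.isProbabilityMeasure_map measurable_subtype_coe.aemeasurable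
  rw [Dist.cdf, cdf_eq_real, map_measureReal_apply measurable_subtype_coe measurableSet_Iic,
    ← integral_indicator_one (measurable_subtype_coe measurableSet_Iic)]
  rfl

/-- The integrated CDF is the expectation of `(t - m)⁺`. -/
lemma Dist.integral_cdf (F : Dist) {t : ℝ} (ht : 0 ≤ t) :
    ∫ r in (0 : ℝ)..t, F.cdf r = ∫ m, max (t - (m : ℝ)) 0 ∂(F : Measure unitInterval) := by
  rw [intervalIntegral.integral_of_le ht, ← integral_Icc_eq_integral_Ioc]
  simp_rw [Dist.cdf_eq_integral]
  have hmeas : Measurable fun q : ℝ × unitInterval =>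
      (if (q.2 : ℝ) ≤ q.1 then 1 else 0 : ℝ) :=
    Measurable.ite (measurableSet_le (by fun_prop) (by fun_prop)) measurable_const measurable_const
  rw [integral_integral_swap]
  · refine integral_congr_ae (Filter.Eventually.of_forall fun m => ?_)
    have h1 : (fun r : ℝ => (if (m : ℝ) ≤ r then 1 else 0 : ℝ)) =
        (Set.Ici (m : ℝ)).indicator 1 := rfl
    have h2 : Set.Ici (m : ℝ) ∩ Set.Icc 0 t = Set.Icc (m : ℝ) t := by
      ext r
      have := m.2.1
      constructor
      · rintro ⟨h, -, h'⟩
        exact ⟨h, h'⟩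
      · rintro ⟨h, h'⟩
        exact ⟨h, this.trans h, h'⟩
    simp only [h1]
    rw [integral_indicator_one measurableSet_Ici, measureReal_restrict_apply measurableSet_Ici, h2,
      Real.volume_real_Icc]
  · exact Integrable.of_bound hmeas.aestronglyMeasurable 1
      (Filter.Eventually.of_forall fun q => by
        simp only [Function.uncurry]
        split_ifs <;> simp)

lemma integrable_hinge (F : Dist) (t : ℝ) :
    Integrable (fun m : unitInterval => max (t - (m : ℝ)) 0) (F : Measure unitInterval) :=
  integrable_of_continuous F (by fun_prop)

/-- Comparison of distributions with the same mean in terms of separating affine functions. -/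
lemma lessInformative_of_separated {F G : Dist} (hmean : F.mean = G.mean)
    (h : ∀ t : unitInterval, ∃ c s : ℝ,
      (∀ᵐ m : unitInterval ∂(F : Measure unitInterval), max ((t : ℝ) - (m : ℝ)) 0 ≤ c + s * (m : ℝ)) ∧
      ∀ᵐ m : unitInterval ∂(G : Measure unitInterval), c + s * (m : ℝ) ≤ max ((t : ℝ) - (m : ℝ)) 0) :
    LessInformative F G := by
  constructor
  · intro t
    rw [F.integral_cdf t.2.1, G.integral_cdf t.2.1]
    obtain ⟨c, s, h1, h2⟩ := h t
    calc _ ≤ ∫ m, (c + s * (m : ℝ)) ∂(F : Measure unitInterval) :=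
          integral_mono_ae (integrable_hinge F t) (integrable_of_continuous F (by fun_prop)) h1
      _ = ∫ m, (c + s * (m : ℝ)) ∂(G : Measure unitInterval) := by
          rw [integral_affine, integral_affine, hmean]
      _ ≤ _ := integral_mono_ae (integrable_of_continuous G (by fun_prop)) (integrable_hinge G t) h2
  · rw [F.integral_cdf zero_le_one, G.integral_cdf zero_le_one]
    -- At t = 1 the hinge is affine on [0, 1], so equality of the integrated CDFs is equality of
    -- means.
    have e : ∀ H : Dist, ∫ m, max (1 - (m : ℝ)) 0 ∂(H : Measure unitInterval) =
        1 + (-1) * H.mean := fun H => by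
      rw [← integral_affine]
      refine integral_congr_ae (Filter.Eventually.of_forall fun m => ?_)
      simp only
      rw [max_eq_left (sub_nonneg.2 m.2.2)]
      ring
    rw [e, e, hmean]

/-- A distribution on `[a, b]` is less informative than one off `(a, b)` with the same mean. -/
lemma lessInformative_of_interval {F G : Dist} {a b : unitInterval}
    (hmean : F.mean = G.mean) (hF : ∀ᵐ m ∂(F : Measure unitInterval), m ∈ Set.Icc a b)
    (hG : ∀ᵐ m ∂(G : Measure unitInterval), m ∉ Set.Ioo a b) : LessInformative F G := by
  refine lessInformative_of_separated hmean fun t => ?_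
  rcases le_or_gt (t : ℝ) a with hta | hta
  · refine ⟨0, 0, ?_, Filter.Eventually.of_forall fun m => by simp⟩
    filter_upwards [hF] with m hm
    have h1 : (a : ℝ) ≤ m := hm.1
    rw [max_eq_right (by linarith)]
    simp
  rcases le_or_gt (b : ℝ) t with htb | htb
  · refine ⟨t, -1, ?_, Filter.Eventually.of_forall fun m => le_max_of_le_left (by linarith)⟩
    filter_upwards [hF] with m hm
    have h1 : (m : ℝ) ≤ b := hm.2
    rw [max_eq_left (by linarith)]
    linarith
  have hd : (0 : ℝ) < b - a := by linarith
  -- The chord over [a, b] of the hinge at t: by convexity it is above the hinge on [a, b] and below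
  -- it off (a, b).
  refine ⟨(t - a) / (b - a) * b, -((t - a) / (b - a)), ?_, ?_⟩
  · filter_upwards [hF] with m hm
    have h1 : (a : ℝ) ≤ m := hm.1
    have h2 : (m : ℝ) ≤ b := hm.2
    have e : ((t : ℝ) - a) / (b - a) * b + -((t - a) / (b - a)) * m =
        (t - a) * (b - m) / (b - a) := by ring
    rw [e, le_div_iff₀ hd, max_mul_of_nonneg _ _ hd.le]
    exact max_le (by nlinarith) (by rw [zero_mul]; exact mul_nonneg (by linarith) (by linarith))
  · filter_upwards [hG] with m hm
    have e : ((t : ℝ) - a) / (b - a) * b + -((t - a) / (b - a)) * m =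
        (t - a) * (b - m) / (b - a) := by ring
    rw [e, div_le_iff₀ hd, max_mul_of_nonneg _ _ hd.le]
    rcases le_or_gt m a with h | h
    · have h' : (m : ℝ) ≤ a := h
      exact le_max_of_le_left (by nlinarith)
    · have h' : (b : ℝ) ≤ m := not_lt.1 fun h' => hm ⟨h, h'⟩
      exact le_max_of_le_right (by rw [zero_mul]; exact mul_nonpos_of_nonneg_of_nonpos (by linarith) (by linarith))

/-- Two integrable functions, one below the other, with reversed integrals agree almost everywhere. -/
lemma ae_eq_of_le_of_integral_le {F : Dist} {f g : unitInterval → ℝ}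
    (hf : Integrable f (F : Measure unitInterval)) (hg : Integrable g (F : Measure unitInterval))
    (hle : ∀ᵐ m ∂(F : Measure unitInterval), f m ≤ g m)
    (hint : ∫ m, g m ∂(F : Measure unitInterval) ≤ ∫ m, f m ∂(F : Measure unitInterval)) :
    ∀ᵐ m ∂(F : Measure unitInterval), f m = g m :=
  (integral_eq_iff_of_ae_le hf hg hle).1 (le_antisymm (integral_mono_ae hf hg hle) hint)

/-- A distribution with no mass on one strict side of its mean is degenerate. -/
lemma ae_eq_mean_of_le {F : Dist} {μ : unitInterval} (hmean : F.mean = μ)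
    (h : ∀ᵐ m ∂(F : Measure unitInterval), m ≤ μ) :
    ∀ᵐ m ∂(F : Measure unitInterval), m = μ := by
  have := ae_eq_of_le_of_integral_le (F := F) (f := fun m => (m : ℝ)) (g := fun _ => (μ : ℝ))
    (integrable_of_continuous F (by fun_prop)) (integrable_const _) h
    (by simpa [Dist.mean] using hmean.ge)
  exact this.mono fun m hm => Subtype.ext hm

lemma ae_eq_mean_of_ge {F : Dist} {μ : unitInterval} (hmean : F.mean = μ)
    (h : ∀ᵐ m ∂(F : Measure unitInterval), μ ≤ m) :
    ∀ᵐ m ∂(F : Measure unitInterval), m = μ := by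
  have := ae_eq_of_le_of_integral_le (F := F) (g := fun m => (m : ℝ)) (f := fun _ => (μ : ℝ))
    (integrable_const _) (integrable_of_continuous F (by fun_prop)) h
    (by simpa [Dist.mean] using hmean.le)
  exact this.mono fun m hm => Subtype.ext hm.symm

/-- A distribution less informative than a degenerate one is degenerate. -/
lemma LessInformative.ae_eq_of_dirac {F G : Dist} (h : LessInformative G F) {μ : unitInterval}
    (hF : ∀ᵐ m ∂(F : Measure unitInterval), m = μ) (hG : G.mean = μ) :
    ∀ᵐ m ∂(G : Measure unitInterval), m = μ := by
  -- The hinge at μ has zero expectation under `F`, hence under `G`, which therefore has no mass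
  -- below μ.
  have h1 := h.1 μ
  rw [F.integral_cdf μ.2.1, G.integral_cdf μ.2.1] at h1
  have h2 : ∫ m, max ((μ : ℝ) - m) 0 ∂(F : Measure unitInterval) = 0 := by
    rw [integral_congr_ae (g := fun _ => (0 : ℝ)) (hF.mono fun m hm => by simp [hm])]
    simp
  have h3 := ae_eq_of_le_of_integral_le (F := G) (f := fun _ => (0 : ℝ)) (integrable_const _)
    (integrable_hinge G μ) (Filter.Eventually.of_forall fun m => le_max_right _ _)
    (by rw [integral_zero]; exact h1.trans_eq h2)
  refine ae_eq_mean_of_ge hG (h3.mono fun m hm => ?_)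
  have : (μ : ℝ) - m ≤ 0 := (le_max_left _ _).trans_eq hm.symm
  exact Subtype.coe_le_coe.1 (sub_nonpos.1 this)

/-- A distribution on `[x, y]` more informative than one on `{x, y}` is itself on `{x, y}`. -/
lemma LessInformative.ae_endpoints {F G : Dist} (h : LessInformative F G) {x μ y : unitInterval}
    (hxμ : x < μ) (hμy : μ < y) (hF : ∀ᵐ m ∂(F : Measure unitInterval), m = x ∨ m = y)
    (hG : ∀ᵐ m ∂(G : Measure unitInterval), m ∈ Set.Icc x y) (hmean : F.mean = G.mean) :
    ∀ᵐ m ∂(G : Measure unitInterval), m = x ∨ m = y := by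
  have h1 := h.1 μ
  rw [F.integral_cdf μ.2.1, G.integral_cdf μ.2.1] at h1
  have hx : (0 : ℝ) < μ - x := sub_pos.2 hxμ
  have hy : (0 : ℝ) < y - μ := sub_pos.2 hμy
  have hd : (0 : ℝ) < y - x := by linarith
  -- The function k (y - m) is the chord over [x, y] of the hinge at μ. It has the same expectation
  -- as the hinge under `F`, so also under `G`; as μ is interior, the two agree only at x and y.
  set k : ℝ := ((μ : ℝ) - x) / (y - x) with hk
  have hkd : k * (y - x) = μ - x := div_mul_cancel₀ _ hd.ne'
  have hk0 : 0 < k := div_pos hx hd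
  have hk1 : k < 1 := by
    rw [hk, div_lt_one hd]
    linarith
  have h2 : ∫ m, max ((μ : ℝ) - m) 0 ∂(F : Measure unitInterval) = k * y + -k * F.mean := by
    rw [← integral_affine]
    refine integral_congr_ae (hF.mono fun m hm => ?_)
    simp only
    rcases hm with rfl | rfl
    · rw [max_eq_left hx.le]
      linarith
    · rw [max_eq_right (by linarith)]
      ring
  have h3 := ae_eq_of_le_of_integral_le (F := G) (g := fun m => k * y + -k * (m : ℝ))
    (integrable_hinge G μ) (integrable_of_continuous G (by fun_prop))
    (hG.mono fun m hm => by
      have e1 : (0 : ℝ) ≤ m - x := sub_nonneg.2 hm.1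
      have e2 : (0 : ℝ) ≤ y - m := sub_nonneg.2 hm.2
      exact max_le (by nlinarith) (by nlinarith))
    (by rw [integral_affine, ← hmean, ← h2]; exact h1)
  filter_upwards [h3] with m hm
  rcases le_total ((μ : ℝ) - m) 0 with h4 | h4
  · rw [max_eq_right h4] at hm
    right
    have : k * ((y : ℝ) - m) = 0 := by linarith
    exact Subtype.ext (by linarith [(mul_eq_zero.1 this).resolve_left hk0.ne'])
  · rw [max_eq_left h4] at hm
    left
    have : (1 - k) * ((m : ℝ) - x) = 0 := by linarith
    exact Subtype.ext (by linarith [(mul_eq_zero.1 this).resolve_left (by linarith)])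

/-! ### Expected payoffs under a dominating line -/

/-- The expected payoff of an integrable function is its integral. -/
lemma expectedPayoff_of_integrable {u : unitInterval → ℝ} {F : Dist}
    (h : Integrable u (F : Measure unitInterval)) :
    expectedPayoff u F = ((∫ m, u m ∂(F : Measure unitInterval) : ℝ) : EReal) := by
  have h1 : ∫⁻ m, ENNReal.ofReal (u m) ∂(F : Measure unitInterval) ≠ ⊤ :=
    h.lintegral_lt_top.ne
  have h2 : ∫⁻ m, ENNReal.ofReal (-u m) ∂(F : Measure unitInterval) ≠ ⊤ :=
    h.neg.lintegral_lt_top.ne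
  rw [expectedPayoff, integral_eq_lintegral_pos_part_sub_lintegral_neg_part h, EReal.coe_sub,
    EReal.coe_ennreal_toReal h1, EReal.coe_ennreal_toReal h2]

/-- The expected payoff of a non-integrable function bounded above is `-∞`. -/
lemma expectedPayoff_of_not_integrable {u : unitInterval → ℝ} (hu : UpperSemicontinuous u)
    {F : Dist} (h : ¬ Integrable u (F : Measure unitInterval)) : expectedPayoff u F = ⊥ := by
  obtain ⟨M, hM⟩ := exists_upper_bound hu
  have h1 : ∫⁻ m, ENNReal.ofReal (u m) ∂(F : Measure unitInterval) < ⊤ := by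
    refine lt_of_le_of_lt (lintegral_mono fun m => ENNReal.ofReal_le_ofReal (hM m)) ?_
    simp
  -- The positive part is bounded, so the failure of integrability comes from the negative part.
  have h2 : ∫⁻ m, ENNReal.ofReal (-u m) ∂(F : Measure unitInterval) = ⊤ := by
    by_contra h2
    apply h
    refine ⟨hu.measurable.aestronglyMeasurable, ?_⟩
    rw [hasFiniteIntegral_iff_norm]
    refine lt_of_le_of_lt (lintegral_mono (g := fun m =>
      ENNReal.ofReal (u m) + ENNReal.ofReal (-u m)) fun m => ?_) ?_
    · rcases le_total 0 (u m) with h0 | h0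
      · rw [Real.norm_of_nonneg h0]
        exact le_self_add
      · rw [Real.norm_of_nonpos h0]
        exact le_add_self
    · rw [lintegral_add_left hu.measurable.ennreal_ofReal]
      exact ENNReal.add_lt_top.2 ⟨h1, lt_top_iff_ne_top.2 h2⟩
  rw [expectedPayoff, h2, EReal.coe_ennreal_top]
  exact EReal.sub_top _

/-- If `u` touches a dominating line almost surely under `F`, its payoff is the value of the line. -/
lemma expectedPayoff_of_ae_eq {u : unitInterval → ℝ} {F : Dist} {c s : ℝ}
    (h : ∀ᵐ m ∂(F : Measure unitInterval), u m = c + s * m) :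
    expectedPayoff u F = ((c + s * F.mean : ℝ) : EReal) := by
  have hi : Integrable u (F : Measure unitInterval) :=
    (integrable_of_continuous F (g := fun m => c + s * (m : ℝ)) (by fun_prop)).congr
      (h.mono fun m hm => hm.symm)
  rw [expectedPayoff_of_integrable hi, integral_congr_ae h, integral_affine]

lemma expectedPayoff_le {u : unitInterval → ℝ} (hu : UpperSemicontinuous u) {F : Dist} {c s : ℝ}
    (h : ∀ᵐ m ∂(F : Measure unitInterval), u m ≤ c + s * m) :
    expectedPayoff u F ≤ ((c + s * F.mean : ℝ) : EReal) := by
  by_cases hi : Integrable u (F : Measure unitInterval)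
  · rw [expectedPayoff_of_integrable hi, EReal.coe_le_coe_iff, ← integral_affine]
    exact integral_mono_ae hi (integrable_of_continuous F (by fun_prop)) h
  · rw [expectedPayoff_of_not_integrable hu hi]
    exact bot_le

/-- The equality case of `expectedPayoff_le`: a finite lower bound rules out the value -∞, so `u` is
integrable and its gap below the line has zero integral. -/
lemma ae_eq_of_le_expectedPayoff {u : unitInterval → ℝ} (hu : UpperSemicontinuous u) {F : Dist}
    {c s : ℝ} (h : ∀ᵐ m ∂(F : Measure unitInterval), u m ≤ c + s * m)
    (hle : ((c + s * F.mean : ℝ) : EReal) ≤ expectedPayoff u F) :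
    ∀ᵐ m ∂(F : Measure unitInterval), u m = c + s * m := by
  by_cases hi : Integrable u (F : Measure unitInterval)
  · rw [expectedPayoff_of_integrable hi, EReal.coe_le_coe_iff, ← integral_affine] at hle
    exact ae_eq_of_le_of_integral_le hi (integrable_of_continuous F (by fun_prop)) h hle
  · rw [expectedPayoff_of_not_integrable hu hi, le_bot_iff] at hle
    exact absurd hle (EReal.coe_ne_bot _)

/-! ### Two-point distributions and binary priors -/

/-- The distribution `p δ_x + (1 - p) δ_y`. -/
noncomputable def twoPoint (p x y : unitInterval) : Dist :=
  ⟨ENNReal.ofReal (p : ℝ) • Measure.dirac x + ENNReal.ofReal (1 - (p : ℝ)) • Measure.dirac y,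
    ⟨by
      simp only [Measure.coe_add, Measure.coe_smul, Pi.add_apply, Pi.smul_apply, measure_univ,
        smul_eq_mul, mul_one]
      rw [← ENNReal.ofReal_add p.2.1 (sub_nonneg.2 p.2.2)]
      simp⟩⟩

lemma binary_twoPoint (p x y : unitInterval) : Binary (twoPoint p x y) := ⟨p, x, y, rfl⟩

lemma twoPoint_ae (p x y : unitInterval) :
    ∀ᵐ m ∂(twoPoint p x y : Measure unitInterval), m = x ∨ m = y := by
  change ∀ᵐ m ∂(ENNReal.ofReal (p : ℝ) • Measure.dirac x +
    ENNReal.ofReal (1 - (p : ℝ)) • Measure.dirac y), m = x ∨ m = y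
  rw [ae_add_measure_iff]
  constructor <;> refine Measure.ae_smul_measure ?_ _ <;>
    · rw [ae_dirac_eq, Filter.eventually_pure]
      simp

lemma twoPoint_mean (p x y : unitInterval) :
    (twoPoint p x y).mean = p * x + (1 - p) * y := by
  change ∫ m, (m : ℝ) ∂(ENNReal.ofReal (p : ℝ) • Measure.dirac x +
    ENNReal.ofReal (1 - (p : ℝ)) • Measure.dirac y) = _
  rw [integral_add_measure, integral_smul_measure, integral_smul_measure, integral_dirac,
    integral_dirac, ENNReal.toReal_ofReal p.2.1, ENNReal.toReal_ofReal (sub_nonneg.2 p.2.2)]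
  · rfl
  · exact (integrable_dirac (by simp)).smul_measure ENNReal.ofReal_ne_top
  · exact (integrable_dirac (by simp)).smul_measure ENNReal.ofReal_ne_top

/-- A distribution on `{a, b}` with given mean. -/
lemma exists_twoPoint_mean {a μ b : unitInterval} (ha : a ≤ μ) (hb : μ ≤ b) :
    ∃ F : Dist, (∀ᵐ m ∂(F : Measure unitInterval), m = a ∨ m = b) ∧ F.mean = μ := by
  rcases ha.eq_or_lt with rfl | ha
  · exact ⟨twoPoint 1 a b, twoPoint_ae _ _ _, by simp [twoPoint_mean]⟩
  rcases hb.eq_or_lt with rfl | hb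
  · exact ⟨twoPoint 0 a μ, twoPoint_ae _ _ _, by simp [twoPoint_mean]⟩
  obtain ⟨p, -, -, -, hp⟩ := exists_weight ha hb
  exact ⟨twoPoint p a b, twoPoint_ae _ _ _, by rw [twoPoint_mean, ← hp]; rfl⟩

/-- A binary distribution is degenerate or has two distinct atoms. -/
lemma Binary.cases {F : Dist} (h : Binary F) :
    (∃ z, ∀ᵐ m ∂(F : Measure unitInterval), m = z) ∨
    ∃ p x y : unitInterval, 0 < p ∧ p < 1 ∧ x < y ∧ F = twoPoint p x y := by
  obtain ⟨p, x, y, h⟩ := h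
  have hF : F = twoPoint p x y := Subtype.ext h
  rcases eq_or_lt_of_le p.2.1 with hp | hp
  · left
    refine ⟨y, ?_⟩
    rw [h, ← hp]
    simp
  rcases eq_or_lt_of_le p.2.2 with hp' | hp'
  · left
    refine ⟨x, ?_⟩
    rw [h, hp']
    simp
  rcases lt_trichotomy x y with hxy | rfl | hxy
  · exact Or.inr ⟨p, x, y, hp, hp', hxy, hF⟩
  · left
    refine ⟨x, ?_⟩
    rw [hF]
    exact (twoPoint_ae _ _ _).mono fun m hm => hm.elim id id
  · right
    refine ⟨unitInterval.symm p, y, x, ?_, ?_, hxy, ?_⟩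
    · exact Subtype.coe_lt_coe.1 (by simpa using hp')
    · exact Subtype.coe_lt_coe.1 (by simpa using hp)
    · rw [hF]
      apply Subtype.ext
      simp only [twoPoint, unitInterval.coe_symm_eq, sub_sub_cancel]
      exact add_comm _ _

/-- The distributions feasible given a binary prior are those on the interval spanned by its atoms
with the same mean. -/
lemma feasible_twoPoint_iff {p x y : unitInterval} (hxy : x < y) {F : Dist} :
    Feasible (twoPoint p x y) F ↔
      (∀ᵐ m ∂(F : Measure unitInterval), m ∈ Set.Icc x y) ∧ F.mean = mix p x y := by
  constructor
  · intro h
    have := h.bounds (a := x) (b := y) ((twoPoint_ae p x y).mono fun m hm => by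
      rcases hm with rfl | rfl
      · exact ⟨le_rfl, hxy.le⟩
      · exact ⟨hxy.le, le_rfl⟩)
    rwa [twoPoint_mean] at this
  · rintro ⟨h1, h2⟩
    exact feasible_of_binary hxy rfl h1 h2

lemma coe_mix (p x y : unitInterval) : (mix p x y : ℝ) = p * x + (1 - p) * y := rfl

lemma mix_mem_Ioo {p x y : unitInterval} (hp : 0 < p) (hp' : p < 1) (hxy : x < y) :
    x < mix p x y ∧ mix p x y < y := by
  have h1 : (0 : ℝ) < p := hp
  have h2 : (p : ℝ) < 1 := hp'
  have h3 : (x : ℝ) < y := hxy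
  constructor <;> rw [← Subtype.coe_lt_coe] <;> simp only [mix] <;> nlinarith

/-! ### Optimal distributions and contact sets -/

/-- If `u` lies below a line on `[x, y]` and some feasible distribution is carried by the points where
they touch, then the optimal distributions are the feasible ones carried by those points. -/
lemma mem_optimal_iff {u : unitInterval → ℝ} (hu : UpperSemicontinuous u) {p x y : unitInterval}
    (hxy : x < y) {c s : ℝ} (hle : ∀ m ∈ Set.Icc x y, u m ≤ c + s * m) {F₁ : Dist}
    (hF₁ : Feasible (twoPoint p x y) F₁)
    (htouch : ∀ᵐ m ∂(F₁ : Measure unitInterval), u m = c + s * m) {F : Dist} :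
    F ∈ optimal u (twoPoint p x y) ↔ Feasible (twoPoint p x y) F ∧
      ∀ᵐ m ∂(F : Measure unitInterval), u m = c + s * m := by
  have hmean := ((feasible_twoPoint_iff hxy).1 hF₁).2
  constructor
  · rintro ⟨hF, hmax⟩
    obtain ⟨hF1, hF2⟩ := (feasible_twoPoint_iff hxy).1 hF
    refine ⟨hF, ae_eq_of_le_expectedPayoff hu (hF1.mono hle) ?_⟩
    have := hmax F₁ hF₁
    rwa [expectedPayoff_of_ae_eq htouch, hmean, ← hF2] at this
  · rintro ⟨hF, ht⟩
    refine ⟨hF, fun G hG => ?_⟩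
    obtain ⟨hG1, hG2⟩ := (feasible_twoPoint_iff hxy).1 hG
    rw [expectedPayoff_of_ae_eq ht, ((feasible_twoPoint_iff hxy).1 hF).2, ← hG2]
    exact expectedPayoff_le hu (hG1.mono hle)

/-- Points of a distribution on `{a, b}` lie in any interval containing `a` and `b`. -/
lemma ae_mem_Icc_of_endpoints {F : Dist} {a b x y : unitInterval}
    (h : ∀ᵐ m ∂(F : Measure unitInterval), m = a ∨ m = b) (ha : a ∈ Set.Icc x y)
    (hb : b ∈ Set.Icc x y) : ∀ᵐ m ∂(F : Measure unitInterval), m ∈ Set.Icc x y :=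
  h.mono fun m hm => by rcases hm with rfl | rfl <;> assumption

/-- Optimal distributions for a nondegenerate binary prior are characterised by a supporting line
that touches the payoff function on both sides of the prior mean. -/
lemma exists_line_optimal {u : unitInterval → ℝ} (hu : UpperSemicontinuous u)
    {p x y : unitInterval} (hp : 0 < p) (hp' : p < 1) (hxy : x < y) :
    ∃ c s : ℝ, (∀ m ∈ Set.Icc x y, u m ≤ c + s * m) ∧
      (∃ a ∈ Set.Icc x (mix p x y), u a = c + s * a) ∧
      (∃ b ∈ Set.Icc (mix p x y) y, u b = c + s * b) ∧
      (∃ F, F ∈ optimal u (twoPoint p x y)) ∧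
      ∀ F, F ∈ optimal u (twoPoint p x y) ↔
        ((∀ᵐ m ∂(F : Measure unitInterval), m ∈ Set.Icc x y) ∧ F.mean = mix p x y) ∧
        ∀ᵐ m ∂(F : Measure unitInterval), u m = c + s * m := by
  obtain ⟨hx, hy⟩ := mix_mem_Ioo hp hp' hxy
  obtain ⟨V, s, hle, ⟨a, ha, hua⟩, b, hb, hub⟩ := exists_support_line hu hx hy
  set μ := mix p x y
  have e : ∀ m : unitInterval, V - s * μ + s * (m : ℝ) = V + s * (m - μ) := fun m => by ring
  obtain ⟨F₁, hF₁, hmean⟩ := exists_twoPoint_mean ha.2 hb.1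
  have hfeas : Feasible (twoPoint p x y) F₁ := (feasible_twoPoint_iff hxy).2
    ⟨ae_mem_Icc_of_endpoints hF₁ ⟨ha.1, ha.2.trans hy.le⟩ ⟨hx.le.trans hb.1, hb.2⟩, hmean⟩
  have hle' : ∀ m ∈ Set.Icc x y, u m ≤ V - s * μ + s * (m : ℝ) := fun m hm => by
    rw [e]
    exact hle m hm
  have ht : ∀ᵐ m ∂(F₁ : Measure unitInterval), u m = V - s * μ + s * (m : ℝ) :=
    hF₁.mono fun m hm => by
      rw [e]
      rcases hm with rfl | rfl <;> assumption
  refine ⟨V - s * μ, s, hle', ⟨a, ha, by rw [e, hua]⟩, ⟨b, hb, by rw [e, hub]⟩,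
    ⟨F₁, (mem_optimal_iff hu hxy hle' hfeas ht).2 ⟨hfeas, ht⟩⟩, fun F => ?_⟩
  rw [mem_optimal_iff hu hxy hle' hfeas ht, feasible_twoPoint_iff hxy]

/-- The set where an upper semicontinuous function lies on or above a line is closed. -/
lemma isClosed_line_le {u : unitInterval → ℝ} (hu : UpperSemicontinuous u) (c s : ℝ) :
    IsClosed {m : unitInterval | c + s * (m : ℝ) ≤ u m} := by
  have h : UpperSemicontinuous fun m : unitInterval => u m + -(c + s * (m : ℝ)) :=
    hu.add (Continuous.upperSemicontinuous (by fun_prop))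
  have h2 := upperSemicontinuous_iff_isClosed_preimage.1 h 0
  convert h2 using 1
  ext m
  rw [Set.mem_preimage, Set.mem_Ici, ← sub_eq_add_neg, sub_nonneg]
  rfl

/-- Below the line, contact is the closed condition of lying on or above it. Compactness supplies
the extreme and the nearest contact points. -/
lemma isCompact_contact {u : unitInterval → ℝ} (hu : UpperSemicontinuous u) {c s : ℝ}
    {x y a b : unitInterval} (hle : ∀ m ∈ Set.Icc x y, u m ≤ c + s * m)
    (hab : Set.Icc a b ⊆ Set.Icc x y) :
    IsCompact {m : unitInterval | m ∈ Set.Icc a b ∧ u m = c + s * (m : ℝ)} := by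
  have : {m : unitInterval | m ∈ Set.Icc a b ∧ u m = c + s * (m : ℝ)} =
      Set.Icc a b ∩ {m : unitInterval | c + s * (m : ℝ) ≤ u m} := by
    ext m
    exact and_congr_right fun hm => ⟨fun h => h.ge, fun h => le_antisymm (hle m (hab hm)) h⟩
  rw [this]
  exact (isClosed_Icc.inter (isClosed_line_le hu c s)).isCompact

/-! ### Ordinal convexity implies comparison of optima -/

/-- If a line above `u` touches it at `z` and `w`, and a line above the more convex `v` touches it
strictly between them, then the latter also touches `v` at `z` and `w`. -/
lemma OrdinallyLessConvex.contact_mem {u v : unitInterval → ℝ} (h : OrdinallyLessConvex u v)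
    {x y z w : unitInterval} {c s c' s' : ℝ} (hu : ∀ m ∈ Set.Icc x y, u m ≤ c + s * m)
    (hv : ∀ m ∈ Set.Icc x y, v m ≤ c' + s' * m) (hz : z ∈ Set.Icc x y) (hw : w ∈ Set.Icc x y)
    (huz : u z = c + s * z) (huw : u w = c + s * w) {m : unitInterval} (hm : m ∈ Set.Ioo z w)
    (hvm : v m = c' + s' * m) : v z = c' + s' * z ∧ v w = c' + s' * w := by
  have hzw : z < w := hm.1.trans hm.2
  have h1 := (h.chord hzw fun k hk => by
    have hd : (0 : ℝ) ≤ w - z := sub_nonneg.2 hzw.le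
    have := mul_le_mul_of_nonneg_right (hu k ⟨hz.1.trans hk.1.le, hk.2.le.trans hw.2⟩) hd
    simp only [chordMul, huz, huw]
    linarith).1 m hm
  -- At m the chord of `v` is on or above the line, while its ends are on or below it; a gap at
  -- either end would put the chord strictly below the line at m.
  simp only [chordMul, hvm] at h1
  have e1 : (0 : ℝ) < m - z := sub_pos.2 hm.1
  have e2 : (0 : ℝ) < w - m := sub_pos.2 hm.2
  have hvz := hv z hz
  have hvw := hv w hw
  constructor
  · refine le_antisymm hvz ?_
    by_contra hlt
    have t1 := mul_lt_mul_of_pos_right (not_le.1 hlt) e2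
    have t2 := mul_le_mul_of_nonneg_right hvw e1.le
    linarith
  · refine le_antisymm hvw ?_
    by_contra hlt
    have t1 := mul_le_mul_of_nonneg_right hvz e2.le
    have t2 := mul_lt_mul_of_pos_right (not_le.1 hlt) e1
    linarith

lemma lessInformative_of_ae_eq {F G : Dist} {μ : unitInterval} (hmean : F.mean = G.mean)
    (hF : ∀ᵐ m ∂(F : Measure unitInterval), m = μ) : LessInformative F G :=
  lessInformative_of_interval (a := μ) (b := μ) hmean (hF.mono fun m hm => by simp [hm])
    (Filter.Eventually.of_forall fun m => by simp)

/-- Every optimum of the less convex payoff is less informative than some optimum of the more convex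
one. -/
lemma OrdinallyLessConvex.exists_more {u v : unitInterval → ℝ} (hu : UpperSemicontinuous u)
    (hv : UpperSemicontinuous v) (h : OrdinallyLessConvex u v) {p x y : unitInterval}
    (hp : 0 < p) (hp' : p < 1) (hxy : x < y) {F : Dist} (hF : F ∈ optimal u (twoPoint p x y)) :
    ∃ F' ∈ optimal v (twoPoint p x y), LessInformative F F' := by
  obtain ⟨hx, hy⟩ := mix_mem_Ioo hp hp' hxy
  obtain ⟨c, s, hule, -, -, -, huopt⟩ := exists_line_optimal hu hp hp' hxy
  obtain ⟨c', s', hvle, ⟨a₀, ha₀, hva₀⟩, ⟨b₀, hb₀, hvb₀⟩, ⟨G, hG⟩, hvopt⟩ :=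
    exists_line_optimal hv hp hp' hxy
  set μ := mix p x y
  obtain ⟨⟨hF1, hF2⟩, hF3⟩ := (huopt F).1 hF
  have hGmean := ((hvopt G).1 hG).1.2
  -- Without contact points of `u` on both strict sides of μ, `F` is degenerate at its mean and less
  -- informative than every optimum for `v`.
  by_cases hz : ∃ z ∈ Set.Icc x y, u z = c + s * z ∧ z < μ
  swap
  · refine ⟨G, hG, lessInformative_of_ae_eq (hF2.trans hGmean.symm) (ae_eq_mean_of_ge hF2 ?_)⟩
    filter_upwards [hF1, hF3] with m h1 h3
    exact not_lt.1 fun hlt => hz ⟨m, h1, h3, hlt⟩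
  by_cases hw : ∃ w ∈ Set.Icc x y, u w = c + s * w ∧ μ < w
  swap
  · refine ⟨G, hG, lessInformative_of_ae_eq (hF2.trans hGmean.symm) (ae_eq_mean_of_le hF2 ?_)⟩
    filter_upwards [hF1, hF3] with m h1 h3
    exact not_lt.1 fun hlt => hw ⟨m, h1, h3, hlt⟩
  obtain ⟨z, hz, huz, hzμ⟩ := hz
  obtain ⟨w, hw, huw, hμw⟩ := hw
  have hK := isCompact_contact hv hvle (le_refl (Set.Icc x y))
  have ha₀' : a₀ ∈ Set.Icc x y := ⟨ha₀.1, ha₀.2.trans hy.le⟩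
  have hb₀' : b₀ ∈ Set.Icc x y := ⟨hx.le.trans hb₀.1, hb₀.2⟩
  obtain ⟨a, ⟨ha, hva⟩, hamin⟩ := hK.exists_isLeast ⟨a₀, ha₀', hva₀⟩
  obtain ⟨b, ⟨hb, hvb⟩, hbmax⟩ := hK.exists_isGreatest ⟨a₀, ha₀', hva₀⟩
  have haμ : a ≤ μ := (hamin ⟨ha₀', hva₀⟩).trans ha₀.2
  have hμb : μ ≤ b := hb₀.1.trans (hbmax ⟨hb₀', hvb₀⟩)
  -- A contact point z' < a of `u` would place a strictly between z' and w, making z' a contact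
  -- point of `v` and contradicting minimality of a.
  have hlow : ∀ z' ∈ Set.Icc x y, u z' = c + s * z' → z' < μ → a ≤ z' := by
    intro z' hz' huz' hz'μ
    by_contra hlt
    rw [not_le] at hlt
    exact absurd (hamin ⟨hz', (h.contact_mem hule hvle hz' hw huz' huw
      ⟨hlt, haμ.trans_lt hμw⟩ hva).1⟩) (not_le.2 hlt)
  have hup : ∀ w' ∈ Set.Icc x y, u w' = c + s * w' → μ < w' → w' ≤ b := by
    intro w' hw' huw' hμw'
    by_contra hlt
    rw [not_le] at hlt
    exact absurd (hbmax ⟨hw', (h.contact_mem hule hvle hz hw' huz huw'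
      ⟨hzμ.trans_le hμb, hlt⟩ hvb).2⟩) (not_le.2 hlt)
  obtain ⟨F', hF', hmean⟩ := exists_twoPoint_mean haμ hμb
  refine ⟨F', (hvopt F').2 ⟨⟨ae_mem_Icc_of_endpoints hF' ha hb, hmean⟩, hF'.mono fun m hm => by
    rcases hm with rfl | rfl <;> assumption⟩, ?_⟩
  refine lessInformative_of_interval (a := a) (b := b) (hF2.trans hmean.symm) ?_ ?_
  · filter_upwards [hF1, hF3] with m h1 h3
    rcases lt_trichotomy m μ with hm | rfl | hm
    · exact ⟨hlow m h1 h3 hm, hm.le.trans hμb⟩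
    · exact ⟨haμ, hμb⟩
    · exact ⟨haμ.trans hm.le, hup m h1 h3 hm⟩
  · filter_upwards [hF'] with m hm
    rcases hm with rfl | rfl
    · exact fun hm => lt_irrefl _ hm.1
    · exact fun hm => lt_irrefl _ hm.2

/-- Every optimum of the more convex payoff is more informative than some optimum of the less convex
one. -/
lemma OrdinallyLessConvex.exists_less {u v : unitInterval → ℝ} (hu : UpperSemicontinuous u)
    (hv : UpperSemicontinuous v) (h : OrdinallyLessConvex u v) {p x y : unitInterval}
    (hp : 0 < p) (hp' : p < 1) (hxy : x < y) {G : Dist} (hG : G ∈ optimal v (twoPoint p x y)) :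
    ∃ G' ∈ optimal u (twoPoint p x y), LessInformative G' G := by
  obtain ⟨hx, hy⟩ := mix_mem_Ioo hp hp' hxy
  obtain ⟨c, s, hule, ⟨a₀, ha₀, hua₀⟩, ⟨b₀, hb₀, hub₀⟩, -, huopt⟩ :=
    exists_line_optimal hu hp hp' hxy
  obtain ⟨c', s', hvle, -, -, -, hvopt⟩ := exists_line_optimal hv hp hp' hxy
  set μ := mix p x y
  obtain ⟨⟨hG1, hG2⟩, hG3⟩ := (hvopt G).1 hG
  have hsub : Set.Icc x μ ⊆ Set.Icc x y := Set.Icc_subset_Icc_right hy.le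
  have hsub' : Set.Icc μ y ⊆ Set.Icc x y := Set.Icc_subset_Icc_left hx.le
  obtain ⟨a, ⟨ha, hua⟩, hamax⟩ :=
    (isCompact_contact hu hule hsub).exists_isGreatest ⟨a₀, ha₀, hua₀⟩
  obtain ⟨b, ⟨hb, hub⟩, hbmin⟩ :=
    (isCompact_contact hu hule hsub').exists_isLeast ⟨b₀, hb₀, hub₀⟩
  obtain ⟨G', hG', hmean⟩ := exists_twoPoint_mean ha.2 hb.1
  refine ⟨G', (huopt G').2 ⟨⟨ae_mem_Icc_of_endpoints hG' (hsub ha) (hsub' hb), hmean⟩,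
    hG'.mono fun m hm => by rcases hm with rfl | rfl <;> assumption⟩, ?_⟩
  have hab : a ≤ b := ha.2.trans hb.1
  refine lessInformative_of_interval (a := a) (b := b) (hmean.trans hG2.symm)
    (ae_mem_Icc_of_endpoints hG' ⟨le_rfl, hab⟩ ⟨hab, le_rfl⟩) ?_
  filter_upwards [hG3] with m hvm hm
  have hmem : ∀ k ∈ Set.Ioo a b, k ∈ Set.Icc x y := fun k hk =>
    ⟨(hsub ha).1.trans hk.1.le, hk.2.le.trans (hsub' hb).2⟩
  have hd : (0 : ℝ) < b - a := sub_pos.2 (hm.1.trans hm.2)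
  -- Contact at m would contradict the choice of a or of b as nearest to μ on its side.
  have hlt : u m < c + s * m := by
    refine (hule m (hmem m hm)).lt_of_ne fun heq => ?_
    rcases le_total m μ with hmμ | hmμ
    · exact absurd (hamax ⟨⟨(hmem m hm).1, hmμ⟩, heq⟩) (not_le.2 hm.1)
    · exact absurd (hbmin ⟨⟨hmμ, (hmem m hm).2⟩, heq⟩) (not_le.2 hm.2)
  have h1 := (h.chord (hm.1.trans hm.2) fun k hk => by
    have := mul_le_mul_of_nonneg_right (hule k (hmem k hk)) hd.le
    simp only [chordMul, hua, hub]
    linarith).2 m hm (by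
      have := mul_lt_mul_of_pos_right hlt hd
      simp only [chordMul, hua, hub]
      linarith)
  -- Contact of `v` at m would put its chord strictly above the line there, although both ends are
  -- on or below the line.
  simp only [chordMul, hvm] at h1
  have t1 := mul_le_mul_of_nonneg_right (hvle a (hsub ha)) (sub_pos.2 hm.2 : (0 : ℝ) < b - m).le
  have t2 := mul_le_mul_of_nonneg_right (hvle b (hsub' hb)) (sub_pos.2 hm.1 : (0 : ℝ) < m - a).le
  linarith

lemma OrdinallyLessConvex.lower {u v : unitInterval → ℝ} (hu : UpperSemicontinuous u)
    (hv : UpperSemicontinuous v) (h : OrdinallyLessConvex u v) {F₀ : Dist} (hF₀ : Binary F₀) :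
    Lower (optimal u F₀) (optimal v F₀) := by
  intro F hF G hG
  rcases hF₀.cases with ⟨z, hz⟩ | ⟨p, x, y, hp, hp', hxy, rfl⟩
  -- A degenerate prior makes every feasible distribution degenerate at the same point, so any two
  -- are comparable.
  · obtain ⟨hF1, hF2⟩ := hF.1.bounds (a := z) (b := z) (hz.mono fun m hm => by simp [hm])
    have hG2 := (hG.1.bounds (a := z) (b := z) (hz.mono fun m hm => by simp [hm])).2
    have hle : LessInformative F G :=
      lessInformative_of_ae_eq (μ := z) (hF2.trans hG2.symm) (hF1.mono fun m hm => by simpa using hm)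
    exact ⟨⟨G, hG, hle⟩, F, hF, hle⟩
  · exact ⟨h.exists_more hu hv hp hp' hxy hF, h.exists_less hu hv hp hp' hxy hG⟩

/-! ### Comparison of optima implies ordinal convexity -/

/-- The chord of a function over `[x, y]` as an affine function. -/
lemma exists_chord (u : unitInterval → ℝ) {x y : unitInterval} (hxy : x < y) :
    ∃ c s : ℝ, u x = c + s * x ∧ u y = c + s * y := by
  have hd : (y : ℝ) - x ≠ 0 := (sub_pos.2 hxy : (0 : ℝ) < y - x).ne'
  refine ⟨u x - (u y - u x) / (y - x) * x, (u y - u x) / (y - x), by ring, ?_⟩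
  field_simp
  ring

/-- Every interior point of `[x, y]` is a mixture of `x` and `y`, so a function below its chord at all
mixtures is below it on `[x, y]`. -/
lemma le_chord_of_mix {u : unitInterval → ℝ} {x y : unitInterval} {c s : ℝ}
    (hux : u x = c + s * x) (huy : u y = c + s * y)
    (h : ∀ t : unitInterval, 0 < t → t < 1 →
      u (mix t x y) ≤ (t : ℝ) * u x + (1 - (t : ℝ)) * u y) :
    ∀ m ∈ Set.Icc x y, u m ≤ c + s * m := by
  intro m hm
  rcases hm.1.eq_or_lt with rfl | h1
  · exact hux.le
  rcases hm.2.eq_or_lt with rfl | h2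
  · exact huy.le
  obtain ⟨t, ht, ht', -, rfl⟩ := exists_weight h1 h2
  have := h t ht ht'
  rw [hux, huy] at this
  rw [coe_mix]
  linarith

lemma twoPoint_feasible (p : unitInterval) {x y : unitInterval} (hxy : x < y) :
    Feasible (twoPoint p x y) (twoPoint p x y) :=
  (feasible_twoPoint_iff hxy).2 ⟨ae_mem_Icc_of_endpoints (twoPoint_ae p x y) ⟨le_rfl, hxy.le⟩
    ⟨hxy.le, le_rfl⟩, twoPoint_mean p x y⟩

lemma ordinallyLessConvex_of_lower {u v : unitInterval → ℝ} (hu : UpperSemicontinuous u)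
    (hv : UpperSemicontinuous v)
    (h : ∀ F₀ : Dist, Binary F₀ → Lower (optimal u F₀) (optimal v F₀)) :
    OrdinallyLessConvex u v := by
  intro x y hxy hchord
  obtain ⟨c, s, hux, huy⟩ := exists_chord u hxy
  obtain ⟨c', s', hvx, hvy⟩ := exists_chord v hxy
  have hule := le_chord_of_mix hux huy hchord
  have htouch : ∀ (w : unitInterval → ℝ) (k r : ℝ), w x = k + r * x → w y = k + r * y →
      ∀ F : Dist, (∀ᵐ m ∂(F : Measure unitInterval), m = x ∨ m = y) →
      ∀ᵐ m ∂(F : Measure unitInterval), w m = k + r * m := fun w k r hx hy F hF =>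
    hF.mono fun m hm => by rcases hm with rfl | rfl <;> assumption
  have huopt : ∀ t F, F ∈ optimal u (twoPoint t x y) ↔ Feasible (twoPoint t x y) F ∧
      ∀ᵐ m ∂(F : Measure unitInterval), u m = c + s * m := fun t F =>
    mem_optimal_iff hu hxy hule (twoPoint_feasible t hxy)
      (htouch u c s hux huy _ (twoPoint_ae t x y))
  have hprior : ∀ t, twoPoint t x y ∈ optimal u (twoPoint t x y) := fun t =>
    (huopt t _).2 ⟨twoPoint_feasible t hxy, htouch u c s hux huy _ (twoPoint_ae t x y)⟩
  have hdirac : ∀ t : unitInterval, 0 < t → t < 1 → ∃ D : Dist, Feasible (twoPoint t x y) D ∧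
      D.mean = mix t x y ∧ ∀ᵐ m ∂(D : Measure unitInterval), m = mix t x y := by
    intro t ht ht'
    obtain ⟨D, hD, hmean⟩ := exists_twoPoint_mean (le_refl (mix t x y)) (le_refl (mix t x y))
    obtain ⟨h1, h2⟩ := mix_mem_Ioo ht ht' hxy
    exact ⟨D, (feasible_twoPoint_iff hxy).2
      ⟨ae_mem_Icc_of_endpoints hD ⟨h1.le, h2.le⟩ ⟨h1.le, h2.le⟩, hmean⟩, hmean,
      hD.mono fun m hm => hm.elim id id⟩
  have hvchord : ∀ t : unitInterval, 0 < t → t < 1 →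
      v (mix t x y) ≤ (t : ℝ) * v x + (1 - (t : ℝ)) * v y := by
    intro t ht ht'
    obtain ⟨hxμ, hμy⟩ := mix_mem_Ioo ht ht' hxy
    -- The weak set order says nothing when one of the sets is empty, so an optimum for `v` has to
    -- be exhibited first.
    obtain ⟨-, -, -, -, -, ⟨G, hG⟩, -⟩ := exists_line_optimal hv ht ht' hxy
    obtain ⟨F', hF', hle⟩ := (h _ (binary_twoPoint t x y) _ (hprior t) G hG).1
    obtain ⟨hF'1, hF'2⟩ := (feasible_twoPoint_iff hxy).1 hF'.1
    -- Carried by {x, y}, `F'` pays the value of the chord of `v` at the mean; optimality compares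
    -- this with the point mass there.
    have hend := hle.ae_endpoints hxμ hμy (twoPoint_ae t x y) hF'1
      ((twoPoint_mean t x y).trans hF'2.symm)
    obtain ⟨D, hD, hDmean, hDae⟩ := hdirac t ht ht'
    have hpay := hF'.2 D hD
    rw [expectedPayoff_of_ae_eq (htouch v c' s' hvx hvy _ hend),
      expectedPayoff_of_ae_eq (c := v (mix t x y)) (s := 0) (hDae.mono fun m hm => by simp [hm]),
      EReal.coe_le_coe_iff, hF'2] at hpay
    rw [hvx, hvy]
    simp only [mix] at hpay ⊢
    linarith
  refine ⟨hvchord, fun t ht ht' hlt => ?_⟩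
  refine (hvchord t ht ht').lt_of_ne fun heq => ?_
  have hvle := le_chord_of_mix hvx hvy hvchord
  obtain ⟨D, hD, hDmean, hDae⟩ := hdirac t ht ht'
  have hDtouch : ∀ᵐ m ∂(D : Measure unitInterval), v m = c' + s' * m := by
    filter_upwards [hDae] with m hm
    rw [hm, heq, hvx, hvy]
    simp only [mix]
    ring
  -- Equality at the mixture makes the point mass `D` optimal for `v`. An optimum for `u` less
  -- informative than `D` is degenerate at the same point, so `u` meets its chord there.
  have hDopt := (mem_optimal_iff hv hxy hvle hD hDtouch).2 ⟨hD, hDtouch⟩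
  obtain ⟨G', hG', hle⟩ := (h _ (binary_twoPoint t x y) _ (hprior t) D hDopt).2
  have hG'ae := hle.ae_eq_of_dirac hDae ((feasible_twoPoint_iff hxy).1 hG'.1).2
  obtain ⟨m, hm, hum⟩ := (hG'ae.and ((huopt t G').1 hG').2).exists
  rw [hm] at hum
  rw [hux, huy, hum] at hlt
  simp only [mix] at hlt
  linarith

end Persuasion

theorem proposition1 (u v : unitInterval → ℝ)
    (hu : UpperSemicontinuous u) (hv : UpperSemicontinuous v) :
    (Persuasion.OrdinallyLessConvex u v →
      ∀ F₀ : Persuasion.Dist, Persuasion.Binary F₀ →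
        Persuasion.Lower (Persuasion.optimal u F₀) (Persuasion.optimal v F₀)) ∧
    ((∀ F₀ : Persuasion.Dist, Persuasion.Binary F₀ →
        Persuasion.Lower (Persuasion.optimal u F₀) (Persuasion.optimal v F₀)) →
      Persuasion.OrdinallyLessConvex u v) :=
  ⟨fun h _ hF₀ => h.lower hu hv hF₀, Persuasion.ordinallyLessConvex_of_lower hu hv⟩
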